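/- \textbf{Definitions.} A \emph{frame} is a pair $(W,R)$ with $W$ a nonempty set and $R\subseteq W\times W$. Put $R^0=\{(x,x):x\in W\}$, $R^{i+1}=R^i\circ R$, and let $R^*=\bigcup_{i\ge 0}R^i$ be the transitive reflexive closure of $R$. Let $x\sim_R y$ iff $xR^*y$ and $yR^*x$; the \emph{height} of $(W,R)$ is the height of the partial order $(W/{\sim_R},\le_R)$, $[x]\le_R[y]\iff xR^*y$, where a partial order has (finite) height $h$ if it contains a chain of cardinality $h$ and no chain of larger cardinality. For natural numbers $m,n,h$ let - $\mathcal F(m,n,h)$ be the class of all frames with $R^n\subseteq R^m$ of height at most $h$, and $\mathcal F_*(m,n)$ the class of all frames with $R^n\subseteq R^m$ of finite height; - $\mathcal G(m,h)$ be the class of all $m$-transitive frames, i.e. frames with $R^*=\bigcup_{0\le i\le m}R^i$, of height at most $h$, and $\mathcal G_*(m)$ the class of all $m$-transitive frames of finite height. For a partition $\mathcal B$ of $W$ (into nonempty, pairwise disjoint sets covering $W$), the \emph{minimal filtration} of $F=(W,R)$ by $\mathcal B$ is the frame $F_{\mathcal B}=(\mathcal B,R_{\mathcal B})$ with $U\,R_{\mathcal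 B}\,V$ iff $uRv$ for some $u\in U$, $v\in V$. A partition $\mathcal B$ is a refinement of $\mathcal A$ if each $B\in\mathcal B$ is contained in some $A\in\mathcal A$. A class $\mathcal K$ of frames \emph{admits minimal filtrations} if for every $F\in\mathcal K$ and every finite partition $\mathcal A$ of the set of points of $F$ there is a finite refinement $\mathcal B$ of $\mathcal A$ with $F_{\mathcal B}\in\mathcal K$. For $f:\mathbb N\to\mathbb N$, it \emph{admits $f$-bounded minimal filtrations} if $\mathcal B$ can always be chosen so that moreover $|\mathcal B|\le f(|\mathcal A|)$. Finally, $\exp_2^0(x)=x$ and $\exp_2^{i+1}(x)=2^{\exp_2^i(x)}$. \textbf{Theorem.} For all integers $n>m\ge 1$ and $h\ge 1$, the classes $\mathcal F(m,n,h)$, $\mathcal F_*(m,n)$, $\mathcal G(m,h)$ and $\mathcal G_*(m)$ admit minimal filtrations. Moreover, there are polynomials $p(x,y,z)$ and $q(x,y)$ with natural number coefficients such that for all integers $n>m\ge 1$ and $h\ge 1$ the class $\mathcal F(m,n,h)$ admits $f$-bounded minimal filtrations for $$f(x)=\exp_2^h\bigl(p(x,h,n-m)\bigr),$$ and the class $\mathcal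 G(m,h)$ admits $f$-bounded minimal filtrations for $$f(x)=\exp_2^h\bigl(q(x,h)\bigr).$$ -/

import Mathlib

universe u

/-- A (Kripke) frame `(W, R)`: a nonempty set with a binary relation on it. -/
structure KripkeFrame : Type (u + 1) where
  /-- the set of points -/
  W : Type u
  /-- the accessibility relation -/
  R : W → W → Prop
  nonempty : Nonempty W

/-- Powers of a binary relation: `R ^ 0` is equality and `R ^ (i + 1) = R ^ i ∘ R`. -/
def relPow {W : Type u} (R : W → W → Prop) : ℕ → W → W → Prop
  | 0 => fun x y => x = y
  | i + 1 => Relation.Comp (relPow R i) R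

/-- A partial order has height `h` if it has a chain of cardinality `h` and no chain of
greater cardinality. -/
def HasOrderHeight (P : Type u) [PartialOrder P] (h : ℕ) : Prop :=
  (∃ c : Set P, IsChain (· ≤ ·) c ∧ c.encard = h) ∧
    ∀ c : Set P, IsChain (· ≤ ·) c → c.encard ≤ h

/-- The tower of exponentials of base `2` and height `i`, with `x` on top. -/
def expTower : ℕ → ℕ → ℕ
  | 0, x => x
  | i + 1, x => 2 ^ expTower i x

/-- The partition `ℬ` refines the partition `𝒜`. -/
def Refines {W : Type u} (ℬ 𝒜 : Set (Set W)) : Prop :=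
  ∀ B ∈ ℬ, ∃ A ∈ 𝒜, B ⊆ A

namespace KripkeFrame

/-- The preorder `R*` (transitive reflexive closure of `R`) on the points of a frame. -/
@[reducible] def preorder (F : KripkeFrame.{u}) : Preorder F.W where
  le := Relation.ReflTransGen F.R
  le_refl _ := Relation.ReflTransGen.refl
  le_trans _ _ _ hxy hyz := Relation.ReflTransGen.trans hxy hyz

/-- The skeleton of a frame: the clusters, that is, the classes of
`x ∼ y ↔ x R* y ∧ y R* x`. -/
def Skeleton (F : KripkeFrame.{u}) : Type u :=
  @Antisymmetrization F.W F.preorder.le (@instIsPreorderLe F.W F.preorder)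

/-- The order of the skeleton: `[x] ≤ [y] ↔ x R* y`. -/
instance (F : KripkeFrame.{u}) : PartialOrder F.Skeleton :=
  @instPartialOrderAntisymmetrization F.W F.preorder

/-- The cluster of a point. -/
def cluster (F : KripkeFrame.{u}) (x : F.W) : F.Skeleton :=
  @toAntisymmetrization F.W F.preorder.le (@instIsPreorderLe F.W F.preorder) x

theorem cluster_le_cluster (F : KripkeFrame.{u}) (x y : F.W) :
    F.cluster x ≤ F.cluster y ↔ Relation.ReflTransGen F.R x y := Iff.rfl

theorem cluster_eq_cluster (F : KripkeFrame.{u}) (x y : F.W) :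
    F.cluster x = F.cluster y ↔
      Relation.ReflTransGen F.R x y ∧ Relation.ReflTransGen F.R y x := by
  rw [le_antisymm_iff, cluster_le_cluster, cluster_le_cluster]

/-- The height of a frame is the height of its skeleton. -/
def HasHeight (F : KripkeFrame.{u}) (h : ℕ) : Prop :=
  HasOrderHeight F.Skeleton h

/-- `F` is an `(m, n)`-frame: `R ^ n ⊆ R ^ m`. -/
def IsMN (F : KripkeFrame.{u}) (m n : ℕ) : Prop :=
  ∀ x y : F.W, relPow F.R n x y → relPow F.R m x y

/-- `F` is `m`-transitive: `R*` is the union of the `R ^ i` with `i ≤ m`. -/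
def IsMTransitive (F : KripkeFrame.{u}) (m : ℕ) : Prop :=
  ∀ x y : F.W, Relation.ReflTransGen F.R x y ↔ ∃ i ≤ m, relPow F.R i x y

/-- The minimal filtration of a frame by a partition `ℬ` of its points: its points are the
elements of `ℬ`, and `U` sees `V` if some point of `U` sees some point of `V`. -/
def filtration (F : KripkeFrame.{u}) (ℬ : Set (Set F.W)) (hℬ : Setoid.IsPartition ℬ) :
    KripkeFrame.{u} where
  W := ↥ℬ
  R U V := ∃ u ∈ (U : Set F.W), ∃ v ∈ (V : Set F.W), F.R u v
  nonempty := F.nonempty.elim fun w => (hℬ.2 w).elim fun B hB _ => ⟨⟨B, hB.1⟩⟩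

end KripkeFrame

/-- The class of all `(m, n)`-frames of height at most `h`. -/
def FBounded (m n h : ℕ) : Set KripkeFrame.{u} :=
  {F | F.IsMN m n ∧ ∃ k ≤ h, F.HasHeight k}

/-- The class of all `(m, n)`-frames of finite height. -/
def FStar (m n : ℕ) : Set KripkeFrame.{u} :=
  {F | F.IsMN m n ∧ ∃ k, F.HasHeight k}

/-- The class of all `m`-transitive frames of height at most `h`. -/
def GBounded (m h : ℕ) : Set KripkeFrame.{u} :=
  {F | F.IsMTransitive m ∧ ∃ k ≤ h, F.HasHeight k}

/-- The class of all `m`-transitive frames of finite height. -/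
def GStar (m : ℕ) : Set KripkeFrame.{u} :=
  {F | F.IsMTransitive m ∧ ∃ k, F.HasHeight k}

/-- A class of frames admits minimal filtrations if every finite partition of the points of a
frame of the class has a finite refinement such that the minimal filtration of the frame by it
is again in the class. -/
def AdmitsMinimalFiltrations (𝓕 : Set KripkeFrame.{u}) : Prop :=
  ∀ F ∈ 𝓕, ∀ 𝒜 : Set (Set F.W), Setoid.IsPartition 𝒜 → 𝒜.Finite →
    ∃ (ℬ : Set (Set F.W)) (hℬ : Setoid.IsPartition ℬ),
      ℬ.Finite ∧ Refines ℬ 𝒜 ∧ F.filtration ℬ hℬ ∈ 𝓕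

/-- A class of frames admits `f`-bounded minimal filtrations if the refinement can moreover be
chosen with at most `f |𝒜|` elements, where `𝒜` is the given partition. -/
def AdmitsBoundedMinimalFiltrations (𝓕 : Set KripkeFrame.{u}) (f : ℕ → ℕ) : Prop :=
  ∀ F ∈ 𝓕, ∀ 𝒜 : Set (Set F.W), Setoid.IsPartition 𝒜 → 𝒜.Finite →
    ∃ (ℬ : Set (Set F.W)) (hℬ : Setoid.IsPartition ℬ),
      ℬ.Finite ∧ Refines ℬ 𝒜 ∧ F.filtration ℬ hℬ ∈ 𝓕 ∧ ℬ.ncard ≤ f 𝒜.ncard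

/-!
The refinement is the partition into the classes of a colouring that is built by induction on the
depth of a point, the number of clusters above it on a longest chain. Paths are considered only
through the residue of their length modulo `N`, with `N = n - m` for the `(m, n)`-frames and
`N = 1` for the `m`-transitive frames.

The colour of a point `u` records the block of `u` in the given partition and, for each residue
`r`, which blocks occur in the cluster of `u`, and which colours occur at smaller depth, among the
endpoints of the paths from `u` whose length has residue `r`. This colouring is tuned: if `u` and
`u'` have the same colour and `u` reaches `v` with residue `r`, then `u'` reaches with residue `r`
some point coloured as `v` (`exists_tuned_colouring`). The only delicate case is that of `v` in
the cluster of `u`. There the paths can be reversed, and a path with residue `r` has a return path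
with residue `-r` (`reverse_residue`), so that the colour of `v` is that of `u` with the
residues shifted by `r`, and likewise for `u'`.

Consequently a path of length `n` in the filtration lifts, from any point of its first block, to a
path of the frame whose length is at least `n` and congruent to `n` modulo `N`
(`KripkeFrame.IsTunedMod.exists_relPow`). In an `(m, n)`-frame such a path, being of length
`m + k (n - m)`, can be replaced by one of length `m`; in an `m`-transitive frame any path can be
replaced by one of length at most `m`. Paths of the frame project to the filtration, which
therefore belongs to the class; since colours determine depths, the height does not grow.

Going one level deeper replaces the number `b` of colours by `b + x 2 ^ (N x) 2 ^ (N b)`, where `x`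
is the number of blocks of the given partition: one exponential for each level
(`colourCount_le_expTower`).
-/

/-! ### Powers of a relation -/

theorem relPow_add {W : Type u} {R : W → W → Prop} {i j : ℕ} {x z : W} :
    relPow R (i + j) x z ↔ ∃ y, relPow R i x y ∧ relPow R j y z := by
  induction j generalizing z with
  | zero => exact ⟨fun h => ⟨z, h, rfl⟩, fun ⟨y, h, hy⟩ => (show y = z from hy) ▸ h⟩
  | succ j ih =>
    constructor
    · rintro ⟨y, hxy, hyz⟩
      obtain ⟨w, hxw, hwy⟩ := ih.1 hxy
      exact ⟨w, hxw, y, hwy, hyz⟩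
    · rintro ⟨w, hxw, y, hwy, hyz⟩
      exact ⟨y, ih.2 ⟨w, hxw, hwy⟩, hyz⟩

theorem reflTransGen_iff_exists_relPow {W : Type u} {R : W → W → Prop} {x y : W} :
    Relation.ReflTransGen R x y ↔ ∃ i, relPow R i x y := by
  constructor
  · intro h
    induction h with
    | refl => exact ⟨0, rfl⟩
    | tail _ hyz ih => exact ih.elim fun i hi => ⟨i + 1, _, hi, hyz⟩
  · rintro ⟨i, hi⟩
    induction i generalizing y with
    | zero => exact (show x = y from hi) ▸ .refl
    | succ i ih =>
      obtain ⟨z, hxz, hzy⟩ := hi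
      exact (ih hxz).tail hzy

/-- If `R ^ n ⊆ R ^ m`, then `R ^ (m + k (n - m)) ⊆ R ^ m` for all `k`. -/
theorem KripkeFrame.IsMN.relPow_of_relPow {F : KripkeFrame.{u}} {m n : ℕ} (hF : F.IsMN m n)
    (hmn : m < n) (k : ℕ) {x y : F.W} (h : relPow F.R (m + (n - m) * k) x y) :
    relPow F.R m x y := by
  induction k with
  | zero => simpa using h
  | succ k ih =>
    have e : m + (n - m) * (k + 1) = n + (n - m) * k := by rw [mul_add]; omega
    rw [e] at h
    obtain ⟨z, hxz, hzy⟩ := relPow_add.1 h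
    exact ih (relPow_add.2 ⟨z, hF _ _ hxz, hzy⟩)

/-- `ModPath R N r u v`: there is an `R`-path from `u` to `v` of positive length congruent to `r`
modulo `N`. -/
def ModPath {W : Type u} (R : W → W → Prop) (N : ℕ) (r : ZMod N) (u v : W) : Prop :=
  ∃ l : ℕ, 1 ≤ l ∧ (l : ZMod N) = r ∧ relPow R l u v

theorem ModPath.trans {W : Type u} {R : W → W → Prop} {N : ℕ} {r s : ZMod N} {u v w : W}
    (huv : ModPath R N r u v) (hvw : ModPath R N s v w) : ModPath R N (r + s) u w := by
  obtain ⟨i, hi, rfl, hi'⟩ := huv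
  obtain ⟨j, hj, rfl, hj'⟩ := hvw
  exact ⟨i + j, by omega, by push_cast; rfl, relPow_add.2 ⟨v, hi', hj'⟩⟩

theorem ModPath.reflTransGen {W : Type u} {R : W → W → Prop} {N : ℕ} {r : ZMod N} {u v : W}
    (h : ModPath R N r u v) : Relation.ReflTransGen R u v :=
  h.elim fun l hl => reflTransGen_iff_exists_relPow.2 ⟨l, hl.2.2⟩

/-! ### Tuned colourings -/

/-- The number of colours used on the points of depth less than `k`, for `x` initial colours and
path lengths modulo `N`. -/
def colourCount (x N : ℕ) : ℕ → ℕ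
  | 0 => 0
  | k + 1 => colourCount x N k + x * ((2 ^ x) ^ N * (2 ^ colourCount x N k) ^ N)

/-- Inside a cluster, a path whose length has residue `r` can be reversed by a path whose length
has residue `-r`. -/
theorem reverse_residue {W : Type u} {N : ℕ} [NeZero N] {T : ZMod N → W → W → Prop}
    (hT : ∀ {r s u v w}, T r u v → T s v w → T (r + s) u w)
    {r s : ZMod N} {u v : W} (huv : T r u v) (hvu : T s v u) : T (-r) v u := by
  have key : ∀ j : ℕ, T (s + j * (r + s)) v u := by
    intro j
    induction j with
    | zero => simpa using hvu
    | succ j ih =>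
      convert hT (hT ih huv) hvu using 1
      push_cast
      ring
  -- the cycle through `u` and `v` is traversed `N` times, less the last passage from `u` to `v`
  convert key (N - 1) using 1
  have hN : ((N - 1 : ℕ) : ZMod N) = -1 := by
    rw [Nat.cast_sub (NeZero.one_le), ZMod.natCast_self]
    simp
  rw [hN]
  ring

/-- A colour of a point `u` of depth `k` records the initial colour of `u`, and for each residue
`r` the initial colours of the points that `u` reaches with residue `r` at the same depth, and the
new colours of those it reaches with residue `r` at smaller depth. -/
theorem exists_tuned_colouring {W α : Type u} [Finite α] {N : ℕ} [NeZero N]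
    {T : ZMod N → W → W → Prop} (hT : ∀ {r s u v w}, T r u v → T s v w → T (r + s) u w)
    {d : W → ℕ} (hd : ∀ {r u v}, T r u v → d v ≤ d u)
    (hback : ∀ {r u v}, T r u v → d v = d u → ∃ s, T s v u) (a : W → α) (k : ℕ) :
    ∃ (β : Type u) (_ : Finite β) (c : {u // d u < k} → β),
      Nat.card β = colourCount (Nat.card α) N k ∧
      (∀ u v, c u = c v → a u = a v ∧ d u = d v) ∧
      ∀ u u', c u = c u' → ∀ r v, T r u.1 v.1 → ∃ v', T r u'.1 v'.1 ∧ c v = c v' := by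
  induction k with
  | zero =>
    exact ⟨PEmpty, inferInstance, fun u => absurd u.2 (Nat.not_lt_zero _),
      by simp [colourCount], fun u => absurd u.2 (Nat.not_lt_zero _),
      fun u => absurd u.2 (Nat.not_lt_zero _)⟩
  | succ k ih =>
    obtain ⟨β, _, c, hcard, hc, hlift⟩ := ih
    let same : W → ZMod N → Set α := fun u r => {x | ∃ v, T r u v ∧ d v = k ∧ a v = x}
    let lower : W → ZMod N → Set β := fun u r => {b | ∃ v, T r u v.1 ∧ c v = b}
    -- inside a cluster, the sets attached to a point determine those of every other point
    have shift : ∀ {r u v}, d u = k → d v = k → T r u v → ∀ s w, T s v w ↔ T (r + s) u w := by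
      intro r u v hu hv huv s w
      refine ⟨hT huv, fun h => ?_⟩
      obtain ⟨s', hs'⟩ := hback huv (hv.trans hu.symm)
      simpa using hT (reverse_residue hT huv hs') h
    have same_shift : ∀ {r u v}, d u = k → d v = k → T r u v →
        same v = fun s => same u (r + s) := by
      intro r u v hu hv huv
      funext s
      simp only [same, shift hu hv huv]
    have lower_shift : ∀ {r u v}, d u = k → d v = k → T r u v →
        lower v = fun s => lower u (r + s) := by
      intro r u v hu hv huv
      funext s
      simp only [lower, shift hu hv huv]
    let c' : {u // d u < k + 1} → β ⊕ (α × (ZMod N → Set α) × (ZMod N → Set β)) := fun u =>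
      if h : d u.1 < k then .inl (c ⟨u.1, h⟩) else .inr (a u.1, same u.1, lower u.1)
    have hlt : ∀ (u : W) (h : d u < k), c' ⟨u, h.trans k.lt_succ_self⟩ = .inl (c ⟨u, h⟩) :=
      fun u h => dif_pos h
    have heq : ∀ (u : W) (h : d u = k),
        c' ⟨u, h ▸ (d u).lt_succ_self⟩ = .inr (a u, same u, lower u) :=
      fun u h => dif_neg (by simp [h])
    refine ⟨_, inferInstance, c', ?_, ?_, ?_⟩
    · have hset : ∀ (γ : Type u) [Finite γ], Nat.card (Set γ) = 2 ^ Nat.card γ := by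
        intro γ _
        have := Fintype.ofFinite γ
        rw [Nat.card_eq_fintype_card, Fintype.card_set, Nat.card_eq_fintype_card]
      rw [Nat.card_sum, Nat.card_prod, Nat.card_prod, Nat.card_fun, Nat.card_fun, hset, hset,
        Nat.card_zmod, hcard, colourCount]
    · rintro ⟨u, hu⟩ ⟨v, hv⟩ h
      rcases Nat.lt_succ_iff_lt_or_eq.1 hu with hu | hu <;>
        rcases Nat.lt_succ_iff_lt_or_eq.1 hv with hv | hv
      · rw [hlt u hu, hlt v hv, Sum.inl.injEq] at h
        exact hc _ _ h
      · rw [hlt u hu, heq v hv] at h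
        cases h
      · rw [heq u hu, hlt v hv] at h
        cases h
      · rw [heq u hu, heq v hv, Sum.inr.injEq, Prod.mk.injEq] at h
        exact ⟨h.1, hu.trans hv.symm⟩
    · rintro ⟨u, hu⟩ ⟨u', hu'⟩ h r ⟨v, hv⟩ huv
      rcases Nat.lt_succ_iff_lt_or_eq.1 hu with hu | hu <;>
        rcases Nat.lt_succ_iff_lt_or_eq.1 hu' with hu' | hu'
      · rw [hlt u hu, hlt u' hu', Sum.inl.injEq] at h
        obtain ⟨v', huv', hcv⟩ := hlift _ _ h r ⟨v, (hd huv).trans_lt hu⟩ huv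
        refine ⟨⟨v'.1, v'.2.trans k.lt_succ_self⟩, huv', ?_⟩
        rw [hlt v ((hd huv).trans_lt hu), hlt v'.1 v'.2, hcv]
      · rw [hlt u hu, heq u' hu'] at h
        cases h
      · rw [heq u hu, hlt u' hu'] at h
        cases h
      · rw [heq u hu, heq u' hu', Sum.inr.injEq, Prod.mk.injEq, Prod.mk.injEq] at h
        obtain ⟨-, hs, hl⟩ := h
        rcases Nat.lt_succ_iff_lt_or_eq.1 hv with hv | hv
        · have hmem : c ⟨v, hv⟩ ∈ lower u r := ⟨⟨v, hv⟩, huv, rfl⟩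
          rw [hl] at hmem
          obtain ⟨v', huv', hcv⟩ := hmem
          refine ⟨⟨v'.1, v'.2.trans k.lt_succ_self⟩, huv', ?_⟩
          rw [hlt v hv, hlt v'.1 v'.2, hcv]
        · have hmem : a v ∈ same u r := ⟨v, huv, hv, rfl⟩
          rw [hs] at hmem
          obtain ⟨v', huv', hv', hav⟩ := hmem
          refine ⟨⟨v', hv' ▸ (d v').lt_succ_self⟩, huv', ?_⟩
          rw [heq v hv, heq v' hv', hav, same_shift hu hv huv, lower_shift hu hv huv,
            same_shift hu' hv' huv', lower_shift hu' hv' huv', hs, hl]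

/-! ### The number of colours -/

theorem le_expTower (k p : ℕ) : p ≤ expTower k p := by
  induction k with
  | zero => exact le_rfl
  | succ k ih => exact ih.trans Nat.lt_two_pow_self.le

/-- Adding `j` on top of a nonempty tower multiplies its value by more than `j`. -/
theorem expTower_mul_le (k p j : ℕ) :
    expTower (k + 1) p * (j + 1) ≤ expTower (k + 1) (p + j) := by
  induction k with
  | zero =>
    simp only [expTower, pow_add]
    exact Nat.mul_le_mul_left _ Nat.lt_two_pow_self
  | succ k ih =>
    have h1 : 1 ≤ expTower (k + 1) p := Nat.one_le_two_pow
    calc expTower (k + 2) p * (j + 1) ≤ 2 ^ expTower (k + 1) p * 2 ^ j :=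
          Nat.mul_le_mul_left _ Nat.lt_two_pow_self
      _ = 2 ^ (expTower (k + 1) p + j) := (pow_add _ _ _).symm
      _ ≤ 2 ^ expTower (k + 1) (p + j) :=
          Nat.pow_le_pow_right two_pos (le_trans (by nlinarith) ih)

theorem colourCount_succ_le (x N k : ℕ) (hN : 1 ≤ N) :
    colourCount x N (k + 1) ≤ 2 ^ ((N + 1) * x + N * colourCount x N k) := by
  set b := colourCount x N k with hb
  have h1 : b ≤ 2 ^ (x * N + b * N) :=
    Nat.lt_two_pow_self.le.trans (Nat.pow_le_pow_right two_pos (by nlinarith))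
  calc colourCount x N (k + 1) = b + x * 2 ^ (x * N + b * N) := by
        rw [colourCount, ← hb, ← pow_mul, ← pow_mul, ← pow_add]
    _ ≤ (x + 1) * 2 ^ (x * N + b * N) := by linarith
    _ ≤ 2 ^ x * 2 ^ (x * N + b * N) := Nat.mul_le_mul_right _ Nat.lt_two_pow_self
    _ = 2 ^ ((N + 1) * x + N * b) := by rw [← pow_add]; congr 1; ring

theorem colourCount_le_expTower (x N h : ℕ) (hN : 1 ≤ N) :
    colourCount x N h ≤ expTower h ((N + 1) * (x + h)) := by
  rcases h with _ | h
  · exact Nat.zero_le _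
  induction h with
  | zero =>
    refine (colourCount_succ_le x N 0 hN).trans (Nat.pow_le_pow_right two_pos ?_)
    simp only [colourCount, expTower]
    nlinarith
  | succ h ih =>
    refine (colourCount_succ_le x N (h + 1) hN).trans (Nat.pow_le_pow_right two_pos ?_)
    set t := expTower (h + 1) ((N + 1) * (x + (h + 1))) with ht
    have h1 : (N + 1) * x ≤ t := le_trans (by nlinarith) (le_expTower (h + 1) _)
    have h2 : t * (N + 1 + 1) ≤ expTower (h + 1) ((N + 1) * (x + (h + 1)) + (N + 1)) :=
      expTower_mul_le _ _ _
    have e : (N + 1) * (x + (h + 1)) + (N + 1) = (N + 1) * (x + (h + 1 + 1)) := by ring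
    rw [e] at h2
    nlinarith

/-! ### Height -/

theorem exists_hasOrderHeight {P : Type u} [PartialOrder P] {h : ℕ}
    (hP : ∀ c : Set P, IsChain (· ≤ ·) c → c.encard ≤ h) : ∃ k ≤ h, HasOrderHeight P k := by
  let S : Set ℕ := {k | ∃ c : Set P, IsChain (· ≤ ·) c ∧ c.encard = k}
  have hb : ∀ k ∈ S, k ≤ h := by
    rintro k ⟨c, hc, hk⟩
    exact_mod_cast hk ▸ hP c hc
  have hS : sSup S ∈ S := Nat.sSup_mem ⟨0, ∅, by simp⟩ ⟨h, hb⟩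
  refine ⟨sSup S, hb _ hS, hS, fun c hc => ?_⟩
  obtain ⟨k, hk⟩ := ENat.ne_top_iff_exists.1 ((hP c hc).trans_lt (ENat.natCast_lt_top h)).ne
  rw [← hk]
  exact_mod_cast le_csSup ⟨h, hb⟩ ⟨c, hc, hk.symm⟩

namespace KripkeFrame

/-- A depth function of a frame of height at most `h`: the depth does not increase along `R*`, and
two points of the same depth that are related by `R*` lie in the same cluster. -/
def IsDepth (F : KripkeFrame.{u}) (h : ℕ) (d : F.W → ℕ) : Prop :=
  (∀ u, d u < h) ∧ ∀ u v, Relation.ReflTransGen F.R u v →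
    d v ≤ d u ∧ (d v = d u → Relation.ReflTransGen F.R v u)

theorem HasHeight.exists_isDepth {F : KripkeFrame.{u}} {h : ℕ} (hF : F.HasHeight h) :
    ∃ d, F.IsDepth h d := by
  have hlt : ∀ a : F.Skeleton, Order.coheight a < h := by
    intro a
    have hlen : ∀ p : LTSeries F.Skeleton, p.length + 1 ≤ h := by
      intro p
      have hc := hF.2 (Set.range p) p.strictMono.monotone.isChain_range
      rw [← Set.image_univ, p.strictMono.injective.encard_image] at hc
      have hc' : ((p.length + 1 : ℕ) : ℕ∞) ≤ h := by simpa using hc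
      exact_mod_cast hc'
    have hh : 1 ≤ h := le_trans (by simp) (hlen (RelSeries.singleton _ a))
    have h1 : Order.coheight a ≤ ((h - 1 : ℕ) : ℕ∞) := by
      refine Order.coheight_le fun p _ => ?_
      have := hlen p
      exact_mod_cast (by omega : p.length ≤ h - 1)
    exact h1.trans_lt (by exact_mod_cast (by omega : h - 1 < h))
  have hcast : ∀ a : F.Skeleton, ((Order.coheight a).toNat : ℕ∞) = Order.coheight a := fun a =>
    ENat.natCast_toNat (ne_top_of_lt (hlt a))
  refine ⟨fun u => (Order.coheight (F.cluster u)).toNat, fun u => ?_, fun u v huv => ⟨?_, ?_⟩⟩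
  · have := hlt (F.cluster u)
    rw [← hcast] at this
    exact_mod_cast this
  · have hle := Order.coheight_anti ((F.cluster_le_cluster u v).2 huv)
    rw [← hcast, ← hcast (F.cluster u)] at hle
    exact_mod_cast hle
  · intro he
    have hle := (F.cluster_le_cluster u v).2 huv
    rcases hle.lt_or_eq with hl | he'
    · have hl' := Order.coheight_strictAnti hl (lt_top_of_lt (hlt _))
      rw [← hcast, ← hcast (F.cluster u)] at hl'
      exact absurd he (ne_of_lt (by exact_mod_cast hl'))
    · exact ((F.cluster_eq_cluster u v).1 he').2

/-- A depth function is injective on every chain of clusters. -/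
theorem IsDepth.exists_hasHeight {F : KripkeFrame.{u}} {h : ℕ} {d : F.W → ℕ}
    (hd : F.IsDepth h d) : ∃ k ≤ h, F.HasHeight k := by
  refine exists_hasOrderHeight fun c hc => ?_
  have hrep : ∀ a : F.Skeleton, ∃ u, F.cluster u = a := Quot.exists_rep
  choose rep hrep using hrep
  have hinj : Set.InjOn (fun a => d (rep a)) c := by
    intro a ha b hb hab
    rw [← hrep a, ← hrep b, cluster_eq_cluster]
    rcases hc.total ha hb with hle | hle <;>
      rw [← hrep a, ← hrep b, cluster_le_cluster] at hle
    · exact ⟨hle, (hd.2 _ _ hle).2 hab.symm⟩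
    · exact ⟨(hd.2 _ _ hle).2 hab, hle⟩
  have := Set.encard_le_encard_of_injOn (t := (Finset.range h : Set ℕ))
    (fun a _ => by simpa using hd.1 (rep a)) hinj
  rwa [Set.encard_coe_eq_coe_finsetCard, Finset.card_range] at this

/-! ### Tuned partitions -/

theorem relPow_filtration {F : KripkeFrame.{u}} {ℬ : Set (Set F.W)} (hℬ : Setoid.IsPartition ℬ)
    {l : ℕ} {u v : F.W} {U V : ↥ℬ} (hu : u ∈ U.1) (hv : v ∈ V.1) (h : relPow F.R l u v) :
    relPow (F.filtration ℬ hℬ).R l U V := by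
  induction l generalizing v V with
  | zero =>
    obtain rfl : u = v := h
    exact Subtype.ext ((hℬ.2 u).unique ⟨U.2, hu⟩ ⟨V.2, hv⟩)
  | succ l ih =>
    obtain ⟨w, huw, hwv⟩ := h
    obtain ⟨X, ⟨hX, hw⟩, -⟩ := hℬ.2 w
    exact ⟨⟨X, hX⟩, ih hw huw, w, hw, v, hv, hwv⟩

/-- A partition is tuned modulo `N` if, whenever a point of `U` sees a point of `V`, every point
of `U` reaches a point of `V` by a path of positive length congruent to `1` modulo `N`. -/
def IsTunedMod (F : KripkeFrame.{u}) (N : ℕ) (ℬ : Set (Set F.W)) : Prop :=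
  ∀ U ∈ ℬ, ∀ V ∈ ℬ, (∃ u ∈ U, ∃ v ∈ V, F.R u v) →
    ∀ u ∈ U, ∃ v ∈ V, ModPath F.R N 1 u v

/-- Paths of the filtration lift to paths of the frame that are at least as long, and of the same
length modulo `N`. -/
theorem IsTunedMod.exists_relPow {F : KripkeFrame.{u}} {N : ℕ} {ℬ : Set (Set F.W)}
    (ht : F.IsTunedMod N ℬ) (hℬ : Setoid.IsPartition ℬ) {n : ℕ} {U V : ↥ℬ}
    (h : relPow (F.filtration ℬ hℬ).R n U V) {u : F.W} (hu : u ∈ U.1) :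
    ∃ v ∈ V.1, ∃ l, n ≤ l ∧ (l : ZMod N) = n ∧ relPow F.R l u v := by
  induction n generalizing V with
  | zero =>
    obtain rfl : U = V := h
    exact ⟨u, hu, 0, le_rfl, rfl, rfl⟩
  | succ n ih =>
    obtain ⟨X, hUX, hXV⟩ := h
    obtain ⟨w, hw, l, hl, hln, huw⟩ := ih hUX
    obtain ⟨v, hv, j, hj, hj1, hwv⟩ := ht X.1 X.2 V.1 V.2 hXV w hw
    exact ⟨v, hv, l + j, by omega, by push_cast; rw [hln, hj1], relPow_add.2 ⟨w, huw, hwv⟩⟩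

theorem IsTunedMod.isMN_filtration {F : KripkeFrame.{u}} {m n : ℕ} (hF : F.IsMN m n)
    (hmn : m < n) {ℬ : Set (Set F.W)} (ht : F.IsTunedMod (n - m) ℬ)
    (hℬ : Setoid.IsPartition ℬ) : (F.filtration ℬ hℬ).IsMN m n := by
  intro U V h
  obtain ⟨u, hu⟩ := Setoid.nonempty_of_mem_partition hℬ U.2
  obtain ⟨v, hv, l, hl, hln, huv⟩ := ht.exists_relPow hℬ h hu
  refine relPow_filtration hℬ hu hv ?_
  rw [ZMod.natCast_eq_natCast_iff] at hln
  obtain ⟨k, hk⟩ := (Nat.modEq_iff_dvd' hl).1 hln.symm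
  refine hF.relPow_of_relPow hmn (k + 1) ?_
  convert huv using 1
  rw [mul_add]
  omega

theorem IsTunedMod.isMTransitive_filtration {F : KripkeFrame.{u}} {m N : ℕ}
    (hF : F.IsMTransitive m) {ℬ : Set (Set F.W)} (ht : F.IsTunedMod N ℬ)
    (hℬ : Setoid.IsPartition ℬ) : (F.filtration ℬ hℬ).IsMTransitive m := by
  refine fun U V => ⟨fun h => ?_, fun ⟨i, _, hi⟩ => reflTransGen_iff_exists_relPow.2 ⟨i, hi⟩⟩
  obtain ⟨j, hj⟩ := reflTransGen_iff_exists_relPow.1 h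
  obtain ⟨u, hu⟩ := Setoid.nonempty_of_mem_partition hℬ U.2
  obtain ⟨v, hv, l, -, -, huv⟩ := ht.exists_relPow hℬ hj hu
  obtain ⟨i, hi, hi'⟩ := (hF u v).1 (reflTransGen_iff_exists_relPow.2 ⟨l, huv⟩)
  exact ⟨i, hi, relPow_filtration hℬ hu hv hi'⟩

/-- If a depth function is constant on the blocks of a tuned partition, it descends to the
filtration, whose height is therefore not larger. -/
theorem IsTunedMod.exists_hasHeight {F : KripkeFrame.{u}} {N h : ℕ} {d : F.W → ℕ}
    (hd : F.IsDepth h d) {ℬ : Set (Set F.W)} (ht : F.IsTunedMod N ℬ)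
    (hℬ : Setoid.IsPartition ℬ) (hconst : ∀ U ∈ ℬ, ∀ u ∈ U, ∀ v ∈ U, d u = d v) :
    ∃ k ≤ h, (F.filtration ℬ hℬ).HasHeight k := by
  have hrep : ∀ U : ↥ℬ, ∃ u, u ∈ U.1 := fun U => Setoid.nonempty_of_mem_partition hℬ U.2
  choose rep hrep using hrep
  refine IsDepth.exists_hasHeight (d := fun U : ↥ℬ => d (rep U)) ⟨fun U => hd.1 _, ?_⟩
  intro U V hUV
  obtain ⟨j, hj⟩ := reflTransGen_iff_exists_relPow.1 hUV
  obtain ⟨v, hv, l, -, -, huv⟩ := ht.exists_relPow hℬ hj (hrep U)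
  have hdv : d (rep V) = d v := hconst V.1 V.2 _ (hrep V) _ hv
  obtain ⟨hle, hback⟩ := hd.2 _ _ (reflTransGen_iff_exists_relPow.2 ⟨l, huv⟩)
  refine ⟨hdv.le.trans hle, fun he => ?_⟩
  obtain ⟨i, hi⟩ := reflTransGen_iff_exists_relPow.1 (hback (hdv.symm.trans he))
  exact reflTransGen_iff_exists_relPow.2 ⟨i, relPow_filtration hℬ hv (hrep U) hi⟩

/-- The blocks of the refinement are the colour classes of a tuned colouring. -/
theorem IsDepth.exists_isTunedMod_refines {F : KripkeFrame.{u}} {h N : ℕ} (hN : 1 ≤ N)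
    {d : F.W → ℕ} (hd : F.IsDepth h d) {𝒜 : Set (Set F.W)} (h𝒜 : Setoid.IsPartition 𝒜)
    (hfin : 𝒜.Finite) :
    ∃ ℬ : Set (Set F.W), Setoid.IsPartition ℬ ∧ ℬ.Finite ∧ Refines ℬ 𝒜 ∧ F.IsTunedMod N ℬ ∧
      (∀ U ∈ ℬ, ∀ u ∈ U, ∀ v ∈ U, d u = d v) ∧
      ℬ.ncard ≤ expTower h ((N + 1) * (𝒜.ncard + h)) := by
  have : NeZero N := ⟨by omega⟩
  have : Finite ↥𝒜 := hfin
  have hblock : ∀ u, ∃ A : ↥𝒜, u ∈ A.1 := fun u =>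
    (h𝒜.2 u).elim fun A hA _ => ⟨⟨A, hA.1⟩, hA.2⟩
  choose block hblock using hblock
  obtain ⟨β, _, c, hcard, hc, hlift⟩ := exists_tuned_colouring (T := ModPath F.R N)
    ModPath.trans (fun huv => (hd.2 _ _ huv.reflTransGen).1) (fun {r u v} huv he => by
      obtain ⟨i, hi⟩ :=
        reflTransGen_iff_exists_relPow.1 ((hd.2 _ _ huv.reflTransGen).2 he)
      obtain ⟨j, hj, -, huv⟩ := huv
      -- going around twice makes the length positive
      exact ⟨_, i + (j + i), by omega, rfl,
        relPow_add.2 ⟨u, hi, relPow_add.2 ⟨v, huv, hi⟩⟩⟩) block h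
  let C : F.W → β := fun u => c ⟨u, hd.1 u⟩
  have hC : ∀ U ∈ (Setoid.ker C).classes, ∀ u ∈ U, ∀ v, v ∈ U ↔ C v = C u := by
    rintro U ⟨w, rfl⟩ u hu v
    have hu : C u = C w := hu
    show C v = C w ↔ _
    rw [hu]
  refine ⟨(Setoid.ker C).classes, Setoid.isPartition_classes _, Setoid.finite_classes_ker C,
    ?_, ?_, ?_, ?_⟩
  · rintro U ⟨w, rfl⟩
    refine ⟨(block w).1, (block w).2, fun u hu => ?_⟩
    have hu : C u = C w := hu
    exact (hc _ _ hu).1 ▸ hblock u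
  · rintro U hU V hV ⟨u₀, hu₀, v₀, hv₀, huv₀⟩ u hu
    obtain ⟨v, huv, hv⟩ := hlift ⟨u₀, hd.1 u₀⟩ ⟨u, hd.1 u⟩ ((hC U hU u hu u₀).1 hu₀) 1
      ⟨v₀, hd.1 v₀⟩ ⟨1, le_rfl, Nat.cast_one, u₀, rfl, huv₀⟩
    exact ⟨v.1, (hC V hV v₀ hv₀ v.1).2 hv.symm, huv⟩
  · exact fun U hU u hu v hv => (hc _ _ ((hC U hU v hv u).1 hu)).2
  · have := Fintype.ofFinite β
    have := (Setoid.finite_classes_ker C).fintype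
    calc (Setoid.ker C).classes.ncard ≤ Nat.card β := by
          rw [← Nat.card_coe_set_eq, Nat.card_eq_fintype_card, Nat.card_eq_fintype_card]
          exact Setoid.card_classes_ker_le C
      _ = colourCount 𝒜.ncard N h := by rw [hcard, Nat.card_coe_set_eq]
      _ ≤ _ := colourCount_le_expTower _ _ _ hN

end KripkeFrame

/-! ### Minimal filtrations of the four classes -/

theorem KripkeFrame.exists_isDepth_of_le {F : KripkeFrame.{u}} {h : ℕ}
    (hF : ∃ k ≤ h, F.HasHeight k) : ∃ d, F.IsDepth h d := by
  obtain ⟨k, hk, hF⟩ := hF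
  obtain ⟨d, hd⟩ := hF.exists_isDepth
  exact ⟨d, fun u => (hd.1 u).trans_le hk, hd.2⟩

theorem FBounded.admitsBoundedMinimalFiltrations {m n : ℕ} (hmn : m < n) (h : ℕ) :
    AdmitsBoundedMinimalFiltrations (FBounded.{u} m n h)
      (fun x => expTower h ((n - m + 1) * (x + h))) := by
  rintro F ⟨hF, hh⟩ 𝒜 h𝒜 hfin
  obtain ⟨d, hd⟩ := KripkeFrame.exists_isDepth_of_le hh
  obtain ⟨ℬ, hℬ, hℬfin, href, ht, hconst, hcard⟩ :=
    hd.exists_isTunedMod_refines (N := n - m) (by omega) h𝒜 hfin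
  exact ⟨ℬ, hℬ, hℬfin, href,
    ⟨ht.isMN_filtration hF hmn hℬ, ht.exists_hasHeight hd hℬ hconst⟩, hcard⟩

theorem GBounded.admitsBoundedMinimalFiltrations (m h : ℕ) :
    AdmitsBoundedMinimalFiltrations (GBounded.{u} m h)
      (fun x => expTower h (2 * (x + h))) := by
  rintro F ⟨hF, hh⟩ 𝒜 h𝒜 hfin
  obtain ⟨d, hd⟩ := KripkeFrame.exists_isDepth_of_le hh
  obtain ⟨ℬ, hℬ, hℬfin, href, ht, hconst, hcard⟩ :=
    hd.exists_isTunedMod_refines (N := 1) le_rfl h𝒜 hfin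
  exact ⟨ℬ, hℬ, hℬfin, href,
    ⟨ht.isMTransitive_filtration hF hℬ, ht.exists_hasHeight hd hℬ hconst⟩, hcard⟩

theorem AdmitsBoundedMinimalFiltrations.admitsMinimalFiltrations {𝓕 : Set KripkeFrame.{u}}
    {f : ℕ → ℕ} (h : AdmitsBoundedMinimalFiltrations 𝓕 f) : AdmitsMinimalFiltrations 𝓕 := by
  intro F hF 𝒜 h𝒜 hfin
  obtain ⟨ℬ, hℬ, hℬfin, href, hmem, -⟩ := h F hF 𝒜 h𝒜 hfin
  exact ⟨ℬ, hℬ, hℬfin, href, hmem⟩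

theorem mainTheorem3 :
    (∀ m n h : ℕ, 1 ≤ m → m < n → 1 ≤ h →
      AdmitsMinimalFiltrations (FBounded.{u} m n h) ∧
      AdmitsMinimalFiltrations (FStar.{u} m n) ∧
      AdmitsMinimalFiltrations (GBounded.{u} m h) ∧
      AdmitsMinimalFiltrations (GStar.{u} m)) ∧
    ∃ (p : MvPolynomial (Fin 3) ℕ) (q : MvPolynomial (Fin 2) ℕ),
      ∀ m n h : ℕ, 1 ≤ m → m < n → 1 ≤ h →
        AdmitsBoundedMinimalFiltrations (FBounded.{u} m n h)
          (fun x => expTower h (MvPolynomial.eval ![x, h, n - m] p)) ∧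
        AdmitsBoundedMinimalFiltrations (GBounded.{u} m h)
          (fun x => expTower h (MvPolynomial.eval ![x, h] q)) := by
  refine ⟨fun m n h _ hmn _ => ?_, ?_⟩
  · refine ⟨(FBounded.admitsBoundedMinimalFiltrations hmn h).admitsMinimalFiltrations, ?_,
      (GBounded.admitsBoundedMinimalFiltrations m h).admitsMinimalFiltrations, ?_⟩
    · rintro F ⟨hF, k, hk⟩ 𝒜 h𝒜 hfin
      obtain ⟨ℬ, hℬ, hℬfin, href, hmn', k', -, hk'⟩ :=
        (FBounded.admitsBoundedMinimalFiltrations hmn k).admitsMinimalFiltrations F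
          ⟨hF, k, le_rfl, hk⟩ 𝒜 h𝒜 hfin
      exact ⟨ℬ, hℬ, hℬfin, href, hmn', k', hk'⟩
    · rintro F ⟨hF, k, hk⟩ 𝒜 h𝒜 hfin
      obtain ⟨ℬ, hℬ, hℬfin, href, hm', k', -, hk'⟩ :=
        (GBounded.admitsBoundedMinimalFiltrations m k).admitsMinimalFiltrations F
          ⟨hF, k, le_rfl, hk⟩ 𝒜 h𝒜 hfin
      exact ⟨ℬ, hℬ, hℬfin, href, hm', k', hk'⟩
  · refine ⟨(.X 2 + 1) * (.X 0 + .X 1), 2 * (.X 0 + .X 1), fun m n h _ hmn _ => ⟨?_, ?_⟩⟩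
    · simpa using FBounded.admitsBoundedMinimalFiltrations.{u} hmn h
    · simpa using GBounded.admitsBoundedMinimalFiltrations.{u} m h
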